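/- Let $(\Omega,\mathcal F,(\mathcal F_t)_{t\ge 0})$ be a filtered measurable space (the $\mathcal F_t$, $t\in\mathbb R_+$, form an increasing family of sub-$\sigma$-algebras of $\mathcal F$) satisfying property (P), that is: (0) $\mathcal F=\bigvee_{t\ge 0}\mathcal F_t$, i.e. $\mathcal F$ is the $\sigma$-algebra generated by all the $\mathcal F_t$, $t\ge 0$; (1) for all $t\ge 0$, $\mathcal F_t$ is generated by a countable number of sets; (2) for all $t\ge 0$, there exist a Polish space $\Omega_t$ and a surjective map $\pi_t:\Omega\to\Omega_t$ such that $\mathcal F_t=\{\pi_t^{-1}(A) : A\subset\Omega_t \text{ Borel}\}$, and such that for all $B\in\mathcal F_t$ and $\omega\in\Omega$, $\pi_t(\omega)\in\pi_t(B)$ implies $\omega\in B$; (3) if $(\omega_n)_{n\ge 0}$ is a sequence of elements of $\Omega$ such that $\bigcap_{n=0}^{N}A_n(\omega_n)\neq\emptyset$ for all integers $N\ge 0$, where $A_n(\omega_n)$ denotes the intersection of all the sets in $\mathcal F_n$ containing $\omega_n$, then $\bigcap_{n=0}^{\infty}A_n(\omega_n)\neq\emptyset$. For every $t\ge 0$ let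 $\mathbb Q_t$ be a probability measure on $(\Omega,\mathcal F_t)$, such that for all $t\ge s\ge 0$, $\mathbb Q_s$ is the restriction of $\mathbb Q_t$ to $\mathcal F_s$. Then there exists a unique measure $\mathbb Q$ on $(\Omega,\mathcal F)$ such that for all $t\ge 0$ the restriction of $\mathbb Q$ to $\mathcal F_t$ is equal to $\mathbb Q_t$, and this $\mathbb Q$ is a probability measure. -/

import Mathlib

open MeasureTheory
open scoped NNReal

universe u v

/-- Property (P) of a filtered measurable space `(Ω, m, (F t)_{t ≥ 0})`. The universe `v` of the
Polish spaces is independent of the universe of `Ω`. -/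
structure PropertyP {Ω : Type u} {m : MeasurableSpace Ω} (F : Filtration ℝ≥0 m) : Prop where
  /-- `m` is the σ-algebra generated by all the `F t`. -/
  eq_iSup : m = ⨆ t : ℝ≥0, F t
  /-- Every `F t` is generated by a countable number of sets. -/
  countablyGenerated : ∀ t : ℝ≥0, @MeasurableSpace.CountablyGenerated Ω (F t)
  /-- Every `F t` is the σ-algebra of the inverse images of the Borel sets under a surjection `π`
  onto a Polish space, and every member of `F t` is saturated for `π`. -/
  exists_polish : ∀ t : ℝ≥0, ∃ (E : Type v) (_ : TopologicalSpace E) (π : Ω → E),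
    PolishSpace E ∧ Function.Surjective π ∧ F t = MeasurableSpace.comap π (borel E) ∧
      ∀ B : Set Ω, MeasurableSet[F t] B → ∀ ω : Ω, π ω ∈ π '' B → ω ∈ B
  /-- `@measurableAtom Ω (F n) ω` is the intersection of all the sets in `F n` containing `ω`. -/
  iInter_atom_nonempty : ∀ w : ℕ → Ω,
    (∀ N : ℕ, (⋂ n : ℕ, ⋂ _ : n ≤ N, @measurableAtom Ω (F (n : ℝ≥0)) (w n)).Nonempty) →
      (⋂ n : ℕ, @measurableAtom Ω (F (n : ℝ≥0)) (w n)).Nonempty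

open ProbabilityTheory Preorder

/-! Kolmogorov extension, transported to `Ω`. Integer times are cofinal, so they suffice. The laws
of `(π 0, …, π n)` under `Q n` are consistent on products of Polish spaces; disintegration and the
Ionescu-Tulcea theorem extend them to `μ` on the infinite product. Since `F n ≤ F (n + 1)`, `π n` is
a Borel function `f n` of `π (n + 1)`, so `μ` is carried by the threads `f n (x (n + 1)) = x n`.
Fibres of `π n` are atoms of `F n`, so (3) gives every thread a point of `Ω` above it; pushing `μ`
along such a choice gives the measure. Uniqueness holds because the union of the `F t` is a
generating π-system. -/

/-- A consistent sequence of probability measures on the finite products of standard Borel spaces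
extends to a probability measure on the infinite product. -/
theorem exists_measure_map_frestrictLe {X : ℕ → Type*} [∀ n, MeasurableSpace (X n)]
    [∀ n, StandardBorelSpace (X n)] [∀ n, Nonempty (X n)]
    (P : ∀ n : ℕ, Measure (∀ i : Finset.Iic n, X i)) [∀ n, IsProbabilityMeasure (P n)]
    (hP : ∀ n, (P (n + 1)).map (frestrictLe₂ n.le_succ) = P n) :
    ∃ R : Measure (∀ n, X n), IsProbabilityMeasure R ∧ ∀ n, R.map (frestrictLe n) = P n := by
  have hsplit (n : ℕ) : Measurable fun x : ∀ i : Finset.Iic (n + 1), X i ↦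
      (frestrictLe₂ (π := X) n.le_succ x, x ⟨n + 1, Finset.mem_Iic.2 le_rfl⟩) :=
    (measurable_frestrictLe₂ _).prodMk (measurable_pi_apply _)
  let ρ (n : ℕ) : Measure ((∀ i : Finset.Iic n, X i) × X (n + 1)) := (P (n + 1)).map fun x ↦
    (frestrictLe₂ (π := X) n.le_succ x, x ⟨n + 1, Finset.mem_Iic.2 le_rfl⟩)
  have hρ (n : ℕ) : IsProbabilityMeasure (ρ n) :=
    Measure.isProbabilityMeasure_map (hsplit n).aemeasurable
  have hfst (n : ℕ) : (ρ n).fst = P n := by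
    rw [Measure.fst, Measure.map_map measurable_fst (hsplit n)]
    exact hP n
  let κ (n : ℕ) : Kernel (∀ i : Finset.Iic n, X i) (X (n + 1)) := (ρ n).condKernel
  have hκ (n : ℕ) : IsMarkovKernel (κ n) := by dsimp only [κ]; infer_instance
  have hstep (n : ℕ) : Kernel.partialTraj κ n (n + 1) ∘ₘ P n = P (n + 1) := by
    have h1 : (Kernel.id ×ₖ κ n) ∘ₘ P n = ρ n := by
      rw [← Measure.compProd_eq_comp_prod, ← hfst n]
      exact (ρ n).disintegrate (ρ n).condKernel
    have h2 : Kernel.partialTraj κ n (n + 1) = (Kernel.id ×ₖ κ n).map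
        (IicProdIoc (X := X) n (n + 1) ∘ Prod.map id (MeasurableEquiv.piSingleton n)) := by
      rw [Kernel.partialTraj_succ_self, Kernel.map_comp_right _ (by fun_prop) (by fun_prop),
        ← Kernel.map_prod_map _ _ measurable_id (by fun_prop), Kernel.map_id]
    have h3 : Measurable (IicProdIoc (X := X) n (n + 1) ∘
        Prod.map id (MeasurableEquiv.piSingleton n)) := by fun_prop
    rw [h2, ← Measure.map_comp _ _ h3, h1, Measure.map_map h3 (hsplit n)]
    -- Gluing the last coordinate back undoes the splitting that defines `ρ n`.
    convert Measure.map_id using 2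
    ext x ⟨i, hi⟩
    obtain hin | rfl := (Finset.mem_Iic.1 hi).lt_or_eq
    · simp [IicProdIoc_def, Nat.lt_succ_iff.1 hin]
    · simp [IicProdIoc_def, MeasurableEquiv.piSingleton]
  have hpartial (n : ℕ) : Kernel.partialTraj κ 0 n ∘ₘ P 0 = P n := by
    induction n with
    | zero => simp
    | succ n ih =>
      rw [Kernel.partialTraj_succ_eq_comp (Nat.zero_le n), ← Measure.comp_assoc, ih, hstep]
  refine ⟨Kernel.traj κ 0 ∘ₘ P 0, inferInstance, fun n ↦ ?_⟩
  rw [Measure.map_comp _ _ (measurable_frestrictLe n), Kernel.traj_map_frestrictLe, hpartial]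

theorem MeasureTheory.Measure.map_trim {α β : Type*} {m₁ m₂ : MeasurableSpace α}
    [MeasurableSpace β] (h : m₁ ≤ m₂) (μ : @Measure α m₂) {f : α → β} (hf : Measurable[m₁] f) :
    @Measure.map α β m₁ _ f (μ.trim h) = @Measure.map α β m₂ _ f μ := by
  ext s hs
  rw [Measure.map_apply hf hs, Measure.map_apply (hf.mono h le_rfl) hs,
    trim_measurableSet_eq h (hf hs)]

/-- The atom of a point in a pulled back σ-algebra is a fibre. -/
theorem measurableAtom_comap {α β : Type*} [MeasurableSpace β] [MeasurableSingletonClass β]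
    (f : α → β) (a : α) : @measurableAtom α (MeasurableSpace.comap f ‹_›) a = f ⁻¹' {f a} := by
  ext b
  simp only [measurableAtom, Set.mem_iInter, Set.mem_preimage, Set.mem_singleton_iff]
  constructor
  · intro h
    exact h (f ⁻¹' {f a}) rfl ⟨_, measurableSet_singleton _, rfl⟩
  · rintro h _ ha ⟨s, -, rfl⟩
    simpa [h] using ha

/-- If `f` generates a smaller σ-algebra than the surjection `g`, it factors through `g`. -/
theorem exists_measurable_factor {α β γ : Type*} [MeasurableSpace β] [MeasurableSpace γ]
    [MeasurableSingletonClass γ] {f : α → γ} {g : α → β} (hg : Function.Surjective g)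
    (hf : Measurable[MeasurableSpace.comap g ‹_›] f) :
    ∃ h : β → γ, Measurable h ∧ ∀ a, h (g a) = f a := by
  -- The chosen preimage is immaterial: the fibre of `f` through `a` is a union of fibres of `g`.
  have key (a : α) : f (Function.surjInv hg (g a)) = f a := by
    obtain ⟨s, -, hs⟩ := hf (measurableSet_singleton (f a))
    have : a ∈ g ⁻¹' s := by rw [hs]; rfl
    have h2 : Function.surjInv hg (g a) ∈ g ⁻¹' s := by
      rw [Set.mem_preimage, Function.surjInv_eq hg]; exact this
    rw [hs] at h2
    exact h2
  refine ⟨fun b ↦ f (Function.surjInv hg b), fun t ht ↦ ?_, key⟩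
  obtain ⟨s, hs, hst⟩ := hf ht
  convert hs using 1
  ext b
  obtain ⟨a, rfl⟩ := hg b
  rw [Set.mem_preimage, key, ← Set.mem_preimage, ← hst, Set.mem_preimage]

/-- A measure which is finite is determined by its restrictions to the members of a filtration
which generates the σ-algebra. -/
theorem ext_of_forall_trim_eq {Ω : Type*} {m : MeasurableSpace Ω} (F : Filtration ℝ≥0 m)
    (hF : m = ⨆ t : ℝ≥0, F t) {R R' : Measure Ω} [IsFiniteMeasure R]
    (h : ∀ t, R.trim (F.le t) = R'.trim (F.le t)) : R = R' := by
  have hs (t : ℝ≥0) (s : Set Ω) (hs : MeasurableSet[F t] s) : R s = R' s := by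
    rw [← trim_measurableSet_eq (F.le t) hs, h t, trim_measurableSet_eq (F.le t) hs]
  refine ext_of_generate_finite {s | ∃ t, MeasurableSet[F t] s} ?_ ?_ ?_ (hs 0 _ .univ)
  · refine hF.trans ((MeasurableSpace.generateFrom_iUnion_measurableSet _).symm.trans ?_)
    congr 1
    ext
    simp
  -- Times are totally ordered, so both sets lie in the later σ-algebra.
  · rintro s ⟨t, ht⟩ s' ⟨t', ht'⟩ -
    exact ⟨max t t', (F.mono (le_max_left t t') _ ht).inter (F.mono (le_max_right t t') _ ht')⟩
  · rintro s ⟨t, ht⟩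
    exact hs t s ht

/-- The existence part of the extension theorem, for the integer times. -/
theorem exists_trim_natCast_eq {Ω : Type u} {m : MeasurableSpace Ω} (F : Filtration ℝ≥0 m)
    (hP : PropertyP.{u, v} F) (Q : ∀ t : ℝ≥0, @Measure Ω (F t))
    (hQ : ∀ t : ℝ≥0, IsProbabilityMeasure (Q t))
    (hcoh : ∀ (s t : ℝ≥0) (hst : s ≤ t), (Q t).trim (F.mono hst) = Q s) :
    ∃ R : Measure Ω, IsProbabilityMeasure R ∧ ∀ n : ℕ, R.trim (F.le n) = Q n := by
  classical
  choose E _ π hE hsurj hFπ _ using fun n : ℕ ↦ hP.exists_polish n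
  let _ (n : ℕ) : MeasurableSpace (E n) := borel (E n)
  have _ (n : ℕ) : BorelSpace (E n) := ⟨rfl⟩
  obtain ⟨ω₀⟩ : Nonempty Ω := by
    have := hQ 0
    exact (Q 0).nonempty_of_neZero
  have _ (n : ℕ) : Nonempty (E n) := ⟨π n ω₀⟩
  have hmono {k n : ℕ} (h : k ≤ n) : F (k : ℝ≥0) ≤ F (n : ℝ≥0) := F.mono (Nat.cast_le.2 h)
  have hπ (n : ℕ) : Measurable[F n] (π n) := by
    rw [measurable_iff_comap_le]
    exact (hFπ n).ge
  have hhist (n : ℕ) : Measurable[F n] fun ω (i : Finset.Iic n) ↦ π i ω :=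
    @measurable_pi_lambda _ _ _ (F n) _ _
      fun i ↦ (hπ i).mono (hmono (Finset.mem_Iic.1 i.2)) le_rfl
  let P (n : ℕ) : Measure (∀ i : Finset.Iic n, E i) :=
    @Measure.map _ _ (F n) _ (fun ω (i : Finset.Iic n) ↦ π i ω) (Q n)
  have _ (n : ℕ) : IsProbabilityMeasure (P n) := by
    have := hQ n
    exact Measure.isProbabilityMeasure_map (hhist n).aemeasurable
  obtain ⟨μ, _, hμ⟩ := exists_measure_map_frestrictLe P fun n ↦ by
    dsimp only [P]
    rw [Measure.map_map (measurable_frestrictLe₂ _) (hhist (n + 1)),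
      ← hcoh n (n + 1 : ℕ) (Nat.cast_le.2 n.le_succ), Measure.map_trim _ _ (hhist n)]
    rfl
  choose f hf hfπ using fun n : ℕ ↦ exists_measurable_factor (f := π n) (hsurj (n + 1)) <| by
    have h := (hπ n).mono (hmono n.le_succ) le_rfl
    rwa [hFπ (n + 1)] at h
  let T : Set (∀ n, E n) := {x | ∀ n, f n (x (n + 1)) = x n}
  have hT : MeasurableSet T := by
    simp only [T, Set.ofPred_forall]
    exact .iInter fun n ↦ measurableSet_eq_fun ((hf n).comp (measurable_pi_apply _))
      (measurable_pi_apply _)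
  have hμT : ∀ᵐ x ∂μ, x ∈ T := by
    refine ae_all_iff.2 fun n ↦ ?_
    have hmeas : MeasurableSet {x : ∀ i : Finset.Iic (n + 1), E i |
        f n (x ⟨n + 1, by simp⟩) = x ⟨n, by simp⟩} :=
      measurableSet_eq_fun ((hf n).comp (measurable_pi_apply _)) (measurable_pi_apply _)
    have h : ∀ᵐ x ∂P (n + 1), f n (x ⟨n + 1, by simp⟩) = x ⟨n, by simp⟩ :=
      (ae_map_iff (hhist (n + 1)).aemeasurable hmeas).2 (.of_forall fun ω ↦ hfπ n ω)
    rw [← hμ (n + 1)] at h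
    exact ae_of_ae_map (measurable_frestrictLe _).aemeasurable h
  have hlift (x : ∀ n, E n) : ∃ ω, x ∈ T → ∀ n, π n ω = x n := by
    by_cases hx : x ∈ T
    swap
    · exact ⟨ω₀, fun h ↦ absurd h hx⟩
    choose w hw using fun n ↦ hsurj n (x n)
    have hatom (n : ℕ) : @measurableAtom Ω (F n) (w n) = π n ⁻¹' {x n} := by
      rw [hFπ n, ← hw n]
      exact measurableAtom_comap (π n) (w n)
    -- Descending along the `f k`, the single point `w n` lies in all atoms up to `n`, whence the
    -- finite intersections in (3) are nonempty.
    have hback (n k : ℕ) (hk : k ≤ n) : π k (w n) = x k := by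
      induction hk using Nat.decreasingInduction with
      | self => exact hw n
      | of_succ k _ ih => rw [← hfπ, ih, hx k]
    obtain ⟨ω, hω⟩ := hP.iInter_atom_nonempty w fun N ↦
      ⟨w N, Set.mem_iInter₂.2 fun n hn ↦ by rw [hatom]; exact hback N n hn⟩
    refine ⟨ω, fun _ n ↦ ?_⟩
    have h := Set.mem_iInter.1 hω n
    rwa [hatom] at h
  choose g hg using hlift
  let G (x : ∀ n, E n) : Ω := if x ∈ T then g x else ω₀
  have hGπ (n : ℕ) : (fun x ↦ π n (G x)) =
      fun x ↦ if x ∈ T then x n else π n ω₀ := by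
    ext x
    by_cases hx : x ∈ T
    · simp [G, hx, hg x hx n]
    · simp [G, hx]
  have hm : m = ⨆ n : ℕ, F n := by
    refine le_antisymm ?_ (iSup_le fun n ↦ F.le n)
    refine hP.eq_iSup.le.trans (iSup_le fun t ↦ ?_)
    obtain ⟨n, hn⟩ := exists_nat_ge t
    exact (F.mono hn).trans (le_iSup (fun n : ℕ ↦ F n) n)
  -- No measurable selection is needed: the `π n` generate `m`, and `π n ∘ G` does not depend on the
  -- choice of `g`.
  have hG : Measurable G := by
    refine measurable_iff_comap_le.2 ((MeasurableSpace.comap_mono hm.le).trans ?_)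
    rw [MeasurableSpace.comap_iSup]
    refine iSup_le fun n ↦ ?_
    rw [hFπ n, MeasurableSpace.comap_comp]
    refine measurable_iff_comap_le.1 (?_ : Measurable fun x ↦ π n (G x))
    rw [hGπ n]
    exact Measurable.ite hT (measurable_pi_apply n) measurable_const
  refine ⟨μ.map G, Measure.isProbabilityMeasure_map hG.aemeasurable, fun n ↦ ?_⟩
  refine @Measure.ext _ (F n) _ _ fun s hs ↦ ?_
  rw [trim_measurableSet_eq _ hs, Measure.map_apply hG (F.le n s hs)]
  rw [hFπ n] at hs
  obtain ⟨B, hB, rfl⟩ := hs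
  have hproj : Measurable fun x : ∀ i : Finset.Iic n, E i ↦ x ⟨n, by simp⟩ :=
    measurable_pi_apply _
  calc μ (G ⁻¹' (π n ⁻¹' B)) = μ ((fun x ↦ x n) ⁻¹' B) := by
        refine measure_congr ?_
        filter_upwards [hμT] with x hx
        refine propext (?_ : π n (G x) ∈ B ↔ x n ∈ B)
        simp [G, hx, hg x hx n]
    _ = P n ((fun x ↦ x ⟨n, by simp⟩) ⁻¹' B) := by
        rw [← hμ n, Measure.map_apply (measurable_frestrictLe n) (hproj hB)]
        rfl
    _ = Q n (π n ⁻¹' B) := by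
        rw [Measure.map_apply (hhist n) (hproj hB)]
        rfl

theorem mainTheorem3 {Ω : Type u} {m : MeasurableSpace Ω} (F : Filtration ℝ≥0 m)
    (hP : PropertyP.{u, v} F)
    (Q : ∀ t : ℝ≥0, @Measure Ω (F t))
    (hQ : ∀ t : ℝ≥0, IsProbabilityMeasure (Q t))
    (hcoh : ∀ (s t : ℝ≥0) (hst : s ≤ t), (Q t).trim (F.mono hst) = Q s) :
    ∃ R : Measure Ω, IsProbabilityMeasure R ∧ (∀ t : ℝ≥0, R.trim (F.le t) = Q t) ∧
      ∀ R' : Measure Ω, (∀ t : ℝ≥0, R'.trim (F.le t) = Q t) → R' = R := by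
  obtain ⟨R, hR, hRn⟩ := exists_trim_natCast_eq F hP Q hQ hcoh
  have hRt (t : ℝ≥0) : R.trim (F.le t) = Q t := by
    obtain ⟨n, hn⟩ := exists_nat_ge t
    rw [← hcoh t n hn, ← hRn n, trim_trim]
  exact ⟨R, hR, hRt, fun R' hR' ↦
    (ext_of_forall_trim_eq F hP.eq_iSup fun t ↦ (hRt t).trans (hR' t).symm).symm⟩
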